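/- Write $\mathbb{N}=\{1,2,3,\dots\}$. A multi-index $\mathbf{k}=(k_1,\dots,k_d)$ of positive integers with $d\ge 1$ is admissible if $k_1>1$, and its multiple $t$-value is $$t(\mathbf{k})=\sum_{m_1>\cdots>m_d>0}\frac{1}{(2m_1-1)^{k_1}\cdots(2m_d-1)^{k_d}}.$$ Let $\mathcal{T}\subset\mathbb{R}$ be the set of all $t(\mathbf{k})$ with $\mathbf{k}$ admissible, and let $\mathcal{T}'$ be the set of accumulation points of $\mathcal{T}$ in $\mathbb{R}$. Then: (a) there is a unique order-reversing bijection $\Phi$ from $\mathcal{T}$ (with the order of $\mathbb{R}$) onto $\mathbb{N}^2$ with the lexicographic order, that is, a bijection with $x\ge y \iff \Phi(x)\le\Phi(y)$; (b) the nonzero elements of $\mathcal{T}'$ can be written, in a unique way, as a sequence $\beta_1>\beta_2>\cdots$ indexed by $\mathbb{N}$; and, with $\beta_0=\infty$, for every $i\in\mathbb{N}$ the set $\mathcal{T}_i=\{\alpha\in\mathcal{T}\mid \beta_{i-1}\ge\alpha>\beta_i\}$ can be written, in a unique way, as a sequence $\alpha_{i,1}>\alpha_{i,2}>\cdots$ indexed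 by $\mathbb{N}$; (c) for every $\alpha\in\mathcal{T}$, $$\Phi(\alpha)=(i,j),\qquad i=\min\{r\in\mathbb{N}\mid \alpha>\beta_r\},\quad j=\min\{s\in\mathbb{N}\mid \alpha\ge\alpha_{i,s}\},$$ where in particular both minima exist. -/

import Mathlib

namespace MultipleT

/-- Admissible multi-indices `(k₁, …, k_d)`: the depth `d` is positive, all entries are positive
integers and `k₁ > 1`. -/
def IsAdmissible {d : ℕ} (k : Fin d → ℕ) : Prop :=
  (∀ i, 0 < k i) ∧ ∃ h : 0 < d, 1 < k ⟨0, h⟩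

/-- The index set of the defining series: tuples `m₁ > ⋯ > m_d > 0` of integers. -/
def Chain (d : ℕ) : Type :=
  {m : Fin d → ℕ // StrictAnti m ∧ ∀ i, 0 < m i}

/-- The multiple `t`-value
`t(k₁, …, k_d) = ∑_{m₁ > ⋯ > m_d > 0} 1 / ((2 m₁ - 1)^{k₁} ⋯ (2 m_d - 1)^{k_d})`. -/
noncomputable def tValue {d : ℕ} (k : Fin d → ℕ) : ℝ :=
  ∑' m : Chain d, 1 / ∏ i, (2 * (m.1 i : ℝ) - 1) ^ k i

/-- The set of all multiple `t`-values. -/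
def tSet : Set ℝ :=
  {x | ∃ (d : ℕ) (k : Fin d → ℕ), IsAdmissible k ∧ x = tValue k}

/-- `Φ` is an order-reversing bijection from the set of multiple `t`-values onto the set of pairs
of positive integers with the lexicographic order. -/
def IsReversingBijection (Φ : tSet → ℕ+ ×ₗ ℕ+) : Prop :=
  Function.Bijective Φ ∧ ∀ x y : tSet, x ≥ y ↔ Φ x ≤ Φ y

/-- `S = {a₁ > a₂ > a₃ > ⋯}`. -/
def IsDecreasingEnumeration (a : ℕ+ → ℝ) (S : Set ℝ) : Prop :=
  StrictAnti a ∧ Set.range a = S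

/-- The elements `x` of the set of multiple `t`-values with `β_i < x ≤ β_{i-1}`, where `β₀ = ∞`
(so there is no upper bound for `i = 1`). -/
def block (β : ℕ+ → ℝ) (i : ℕ+) : Set ℝ :=
  {x | x ∈ tSet ∧ β i < x ∧ ∀ j : ℕ+, j + 1 = i → x ≤ β j}

end MultipleT

namespace MultipleT

open Filter Topology Set

/-! ### Decreasing enumerations -/

/-! Fix all exponents but the last and let the last one grow. The values strictly decrease to a
positive limit, the part of the series with `m_d = 1` (`strictAnti_tValue_index`,
`tendsto_tValue_index`). Only finitely many of these sequences start above a given `ε > 0`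
(`finite_setOf_lt_tValue`): `t(2,1,…,1)` tends to `0` with the depth, and at fixed depth raising a
non-last exponent costs a factor `1/3` per unit.

The rest is formal. Above any `p > 0` only finitely many sequences matter, so the nonzero
accumulation points are exactly the limits, and they form a decreasing sequence. Each block contains
a tail of a sequence tending to its lower end and has finitely many elements above each of its
points, so it is a decreasing sequence too. Concatenating the blocks gives the order type, and
rigidity of well-orders gives uniqueness. Coincidences between values or limits do no harm. -/

theorem IsDecreasingEnumeration.unique {a b : ℕ+ → ℝ} {S : Set ℝ}
    (ha : IsDecreasingEnumeration a S) (hb : IsDecreasingEnumeration b S) : a = b := by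
  have h : OrderDual.toDual ∘ a = OrderDual.toDual ∘ b := by
    refine (StrictMono.range_inj ha.1.dual_right hb.1.dual_right).1 ?_
    rw [range_comp, range_comp, ha.2, hb.2]
  exact funext fun n => congrFun h n

/-- An infinite set with finitely many elements above each of its elements is a decreasing
sequence, in a unique way. -/
theorem existsUnique_isDecreasingEnumeration {B : Set ℝ} (hB : B.Infinite)
    (hfin : ∀ x ∈ B, (B ∩ Ioi x).Finite) : ∃! a : ℕ+ → ℝ, IsDecreasingEnumeration a B := by
  classical
  suffices h : ∃ a : ℕ+ → ℝ, IsDecreasingEnumeration a B by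
    obtain ⟨a, ha⟩ := h
    exact ⟨a, ha, fun b hb => hb.unique ha⟩
  have : Infinite B := hB.to_subtype
  -- The rank of `x` counts the elements above it; its range, an infinite subset of `ℕ`, is order
  -- isomorphic to `ℕ+`.
  let f : B → ℕ := fun x => (B ∩ Ioi (x : ℝ)).ncard
  have hf : StrictAnti f := by
    intro x y hxy
    refine ncard_lt_ncard ⟨fun z hz => ⟨hz.1, lt_trans (show (x : ℝ) < y from hxy) hz.2⟩, fun h => ?_⟩ (hfin x x.2)
    exact lt_irrefl (y : ℝ) (h ⟨y.2, hxy⟩).2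
  have hinf : (range f).Infinite := infinite_range_of_injective hf.injective
  have : Infinite (range f) := hinf.to_subtype
  let e : ℕ+ ≃o range f := OrderIso.pnatIsoNat.trans (Nat.Subtype.orderIsoOfNat (range f))
  let g : range f ≃ B := (Equiv.ofInjective f hf.injective).symm
  have hg : ∀ n, f (g n) = n := fun n => Equiv.apply_ofInjective_symm hf.injective n
  refine ⟨fun n => (g (e n) : ℝ), fun m n hmn => ?_, ?_⟩
  · have : f (g (e m)) < f (g (e n)) := by
      rw [hg, hg]; exact e.strictMono hmn
    exact hf.lt_iff_gt.1 this
  · ext x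
    constructor
    · rintro ⟨n, rfl⟩
      exact (g (e n)).2
    · intro hx
      exact ⟨e.symm (g.symm ⟨x, hx⟩), by simp⟩

/-! ### Families of sequences decreasing to positive limits -/

section Family

variable {ι : Type*} {T : ι → ℕ → ℝ} {τ : ι → ℝ}

/-- Only finitely many sequences ever exceed `p`, and each of them meets `B` finitely often: it
drops below `p` or misses `B` altogether. -/
theorem finite_of_eventually_avoid (hanti : ∀ i, StrictAnti (T i))
    (hlim : ∀ i, Tendsto (T i) atTop (𝓝 (τ i)))
    (hfin : ∀ ε > 0, {i | ε < T i 0}.Finite) {p : ℝ} (hp : 0 < p) {B : Set ℝ}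
    (hB : ∀ x ∈ B, p < x ∧ ∃ i n, T i n = x)
    (h : ∀ i, τ i < p ∨ ∀ n, T i n ∉ B) : B.Finite := by
  have hsub : B ⊆ ⋃ i ∈ {i | p < T i 0}, (range (T i) ∩ B) := by
    intro x hx
    obtain ⟨hpx, i, n, rfl⟩ := hB x hx
    exact mem_biUnion (show p < T i 0 from hpx.trans_le ((hanti i).antitone (Nat.zero_le n)))
      ⟨⟨n, rfl⟩, hx⟩
  refine ((hfin p hp).biUnion fun i _ => ?_).subset hsub
  rcases h i with hi | hi
  · obtain ⟨N, hN⟩ := eventually_atTop.1 ((hlim i).eventually_lt_const hi)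
    refine ((finite_lt_nat N).image (T i)).subset ?_
    rintro _ ⟨⟨n, rfl⟩, hx⟩
    refine ⟨n, ?_, rfl⟩
    by_contra hn
    exact lt_asymm (hB _ hx).1 (hN n (not_lt.1 hn))
  · refine finite_empty.subset ?_
    rintro _ ⟨⟨n, rfl⟩, hx⟩
    exact hi n hx

theorem lt_of_strictAnti_tendsto {u : ℕ → ℝ} {l : ℝ} (hu : StrictAnti u)
    (hl : Tendsto u atTop (𝓝 l)) (n : ℕ) : l < u n :=
  (hu.antitone.le_of_tendsto hl (n + 1)).trans_lt (hu (Nat.lt_succ_self n))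

theorem finite_range_inter_Ioi (hanti : ∀ i, StrictAnti (T i))
    (hlim : ∀ i, Tendsto (T i) atTop (𝓝 (τ i)))
    (hfin : ∀ ε > 0, {i | ε < T i 0}.Finite) {p : ℝ} (hp : 0 < p) :
    (range τ ∩ Ioi p).Finite := by
  refine ((hfin p hp).image τ).subset ?_
  rintro _ ⟨⟨i, rfl⟩, hi⟩
  exact ⟨i, lt_trans hi (lt_of_strictAnti_tendsto (hanti i) (hlim i) 0), rfl⟩

/-- Limits may coincide, but a positive value is the limit of only finitely many sequences, since
those all start above it. -/
theorem infinite_range_limit [Infinite ι] (hanti : ∀ i, StrictAnti (T i))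
    (hlim : ∀ i, Tendsto (T i) atTop (𝓝 (τ i))) (hpos : ∀ i, 0 < τ i)
    (hfin : ∀ ε > 0, {i | ε < T i 0}.Finite) : (range τ).Infinite := by
  intro h
  have : (τ ⁻¹' (range τ)).Finite := by
    refine h.preimage' ?_
    rintro _ ⟨i, rfl⟩
    refine (hfin _ (hpos i)).subset fun j (hj : τ j = τ i) => ?_
    exact hj ▸ lt_of_strictAnti_tendsto (hanti j) (hlim j) 0
  rw [preimage_range] at this
  exact infinite_univ this

theorem derivedSet_diff_zero (hanti : ∀ i, StrictAnti (T i))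
    (hlim : ∀ i, Tendsto (T i) atTop (𝓝 (τ i))) (hpos : ∀ i, 0 < τ i)
    (hfin : ∀ ε > 0, {i | ε < T i 0}.Finite) {A : Set ℝ} (hA : A = {x | ∃ i n, T i n = x}) :
    derivedSet A \ {0} = range τ := by
  have hlt := fun i => lt_of_strictAnti_tendsto (hanti i) (hlim i)
  ext x
  rw [Set.mem_sdiff, mem_singleton_iff, mem_derivedSet]
  constructor
  · rintro ⟨hx, hx0⟩
    have hx1 : 0 < x := by
      refine lt_of_le_of_ne ?_ (Ne.symm hx0)
      by_contra hneg
      have h := accPt_iff_frequently.1 hx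
      obtain ⟨y, ⟨-, hy⟩, hy0⟩ := (h.and_eventually (Iio_mem_nhds (not_le.1 hneg))).exists
      rw [hA] at hy
      obtain ⟨i, n, rfl⟩ := hy
      exact lt_asymm ((hpos i).trans (hlt i n)) hy0
    by_contra hnot
    have hF := finite_range_inter_Ioi hanti hlim hfin (half_pos hx1)
    have hnhds : (range τ ∩ Ioi (x / 2))ᶜ ∩ Ioi (x / 2) ∈ 𝓝 x :=
      inter_mem (hF.isClosed.isOpen_compl.mem_nhds fun h => hnot h.1)
        (Ioi_mem_nhds (half_lt_self hx1))
    obtain ⟨p, q, ⟨hpx, hxq⟩, hpq⟩ := mem_nhds_iff_exists_Ioo_subset.1 hnhds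
    -- Shrinking to `p' > p` puts every limit in `[p', q)` inside the limit-free interval `(p, q)`.
    -- A sequence meeting `(p', q)` has limit below `q`, hence below `p'`.
    obtain ⟨p', hp', hp'x⟩ := exists_between hpx
    have hp0 : 0 < p' := (half_pos hx1).trans (hpq ⟨hp', hp'x.trans hxq⟩).2
    have hfinB : (A ∩ Ioo p' q).Finite := by
      refine finite_of_eventually_avoid hanti hlim hfin hp0 (fun y hy => ⟨hy.2.1, ?_⟩) fun i => ?_
      · have := hy.1
        rwa [hA] at this
      · rcases lt_or_ge (τ i) p' with h | h
        · exact Or.inl h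
        · refine Or.inr fun n hn => ?_
          have hq : τ i < q := (hlt i n).trans hn.2.2
          have hmem := hpq ⟨hp'.trans_le h, hq⟩
          exact hmem.1 ⟨⟨i, rfl⟩, hmem.2⟩
    have hacc : ∃ᶠ y in 𝓝 x, y ∈ (A ∩ Ioo p' q) \ {x} :=
      ((accPt_iff_frequently.1 hx).and_eventually (Ioo_mem_nhds hp'x hxq)).mono
        fun y hy => ⟨⟨hy.1.2, hy.2⟩, hy.1.1⟩
    have hcl := mem_closure_iff_frequently.2 hacc
    rw [(hfinB.subset sdiff_subset).isClosed.closure_eq] at hcl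
    exact hcl.2 rfl
  · rintro ⟨i, rfl⟩
    refine ⟨accPt_iff_frequently.2 ?_, (hpos i).ne'⟩
    refine (hlim i).frequently (Frequently.of_forall fun n => ⟨(hlt i n).ne', ?_⟩)
    rw [hA]
    exact ⟨i, n, rfl⟩

end Family

/-! ### The blocks and the order type -/

theorem le_of_mem_block {β : ℕ+ → ℝ} (hβ : StrictAnti β) {i r : ℕ+} {x : ℝ} (hx : x ∈ block β i)
    (hr : r < i) : x ≤ β r := by
  have hi : i - 1 + 1 = i := PNat.sub_add_of_lt (lt_of_le_of_lt (one_le) hr)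
  refine (hx.2.2 (i - 1) hi).trans (hβ.antitone ?_)
  rw [← hi] at hr
  exact PNat.lt_add_one_iff.1 hr

theorem isLeast_of_mem_block {β : ℕ+ → ℝ} (hβ : StrictAnti β) {i : ℕ+} {x : ℝ}
    (hx : x ∈ block β i) : IsLeast {r : ℕ+ | x > β r} i :=
  ⟨hx.2.1, fun _ hr => not_lt.1 fun h => not_lt.2 (le_of_mem_block hβ hx h) hr⟩

theorem exists_mem_block {β : ℕ+ → ℝ} {x : ℝ} (hx : x ∈ tSet) (h : ∃ r, β r < x) :
    ∃ i, x ∈ block β i := by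
  classical
  refine ⟨PNat.find h, hx, PNat.find_spec h, fun j hj => not_lt.1 (PNat.find_min h ?_)⟩
  rw [← hj]
  exact PNat.lt_add_right j 1

theorem strictAnti_of_blocks {β : ℕ+ → ℝ} (hβ : StrictAnti β) {α : ℕ+ → ℕ+ → ℝ}
    (hα : ∀ i, IsDecreasingEnumeration (α i) (block β i)) :
    StrictAnti fun p : ℕ+ ×ₗ ℕ+ => α (ofLex p).1 (ofLex p).2 := by
  intro p q hpq
  have hmem : ∀ i j, α i j ∈ block β i := fun i j => (hα i).2 ▸ mem_range_self j
  rcases Prod.Lex.lt_iff.1 hpq with h | ⟨h1, h2⟩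
  · exact (le_of_mem_block hβ (hmem _ _) h).trans_lt (hmem _ _).2.1
  · simp only [← h1]
    exact (hα _).1 h2

theorem IsReversingBijection.unique {Φ Ψ : tSet → ℕ+ ×ₗ ℕ+} (hΦ : IsReversingBijection Φ)
    (hΨ : IsReversingBijection Ψ) : Φ = Ψ := by
  let e : ∀ Θ : tSet → ℕ+ ×ₗ ℕ+, IsReversingBijection Θ → tSetᵒᵈ ≃o ℕ+ ×ₗ ℕ+ := fun Θ h =>
    { toEquiv := OrderDual.ofDual.trans (Equiv.ofBijective Θ h.1)
      map_rel_iff' := fun {x y} => (h.2 x.ofDual y.ofDual).symm }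
  -- Order isomorphisms onto a well-order are unique.
  have h : e Φ hΦ = e Ψ hΨ := Subsingleton.elim _ _
  funext x
  exact DFunLike.congr_fun h (OrderDual.toDual x)

theorem exists_isReversingBijection {β : ℕ+ → ℝ} (hβ : StrictAnti β)
    (hex : ∀ x ∈ tSet, ∃ r, β r < x) {α : ℕ+ → ℕ+ → ℝ}
    (hα : ∀ i, IsDecreasingEnumeration (α i) (block β i)) :
    ∃ Φ : tSet → ℕ+ ×ₗ ℕ+, IsReversingBijection Φ ∧
      ∀ (x : tSet) i j, α i j = (x : ℝ) → Φ x = toLex (i, j) := by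
  have hmem : ∀ i j, α i j ∈ block β i := fun i j => (hα i).2 ▸ mem_range_self j
  have hanti := strictAnti_of_blocks hβ hα
  let g : ℕ+ ×ₗ ℕ+ → tSet := fun p => ⟨α (ofLex p).1 (ofLex p).2, (hmem _ _).1⟩
  have hg : StrictAnti g := fun p q h => hanti h
  have hsurj : Function.Surjective g := by
    intro x
    obtain ⟨i, hi⟩ := exists_mem_block x.2 (hex x x.2)
    rw [← (hα i).2] at hi
    obtain ⟨j, hj⟩ := hi
    exact ⟨toLex (i, j), Subtype.ext hj⟩
  let G := Equiv.ofBijective g ⟨hg.injective, hsurj⟩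
  refine ⟨G.symm, ⟨G.symm.bijective, fun x y => ?_⟩, fun x i j h => ?_⟩
  · rw [← hg.le_iff_ge]
    change _ ↔ G (G.symm y) ≤ G (G.symm x)
    rw [G.apply_symm_apply, G.apply_symm_apply]
  · rw [Equiv.symm_apply_eq]
    exact Subtype.ext h.symm

/-- If the multiple `t`-values split into infinitely many strictly decreasing sequences with
positive limits, finitely many of which start above any given positive number, then they have
reversed order type `ω²`, the limits being the nonzero accumulation points. -/
theorem order_structure_of_family {ι : Type*} [Infinite ι] {T : ι → ℕ → ℝ} {τ : ι → ℝ}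
    (hanti : ∀ i, StrictAnti (T i)) (hlim : ∀ i, Tendsto (T i) atTop (𝓝 (τ i)))
    (hpos : ∀ i, 0 < τ i) (hfin : ∀ ε > 0, {i | ε < T i 0}.Finite)
    (hA : tSet = {x | ∃ i n, T i n = x}) :
    (∃! Φ : tSet → ℕ+ ×ₗ ℕ+, IsReversingBijection Φ) ∧
    (∃! β : ℕ+ → ℝ, IsDecreasingEnumeration β (derivedSet tSet \ {0})) ∧
    ∀ β : ℕ+ → ℝ, IsDecreasingEnumeration β (derivedSet tSet \ {0}) →
      (∀ i : ℕ+, ∃! a : ℕ+ → ℝ, IsDecreasingEnumeration a (block β i)) ∧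
      ∀ α : ℕ+ → ℕ+ → ℝ, (∀ i : ℕ+, IsDecreasingEnumeration (α i) (block β i)) →
        ∀ Φ : tSet → ℕ+ ×ₗ ℕ+, IsReversingBijection Φ →
        ∀ x : tSet, ∃ i j : ℕ+,
          IsLeast {r : ℕ+ | (x : ℝ) > β r} i ∧
          IsLeast {s : ℕ+ | (x : ℝ) ≥ α i s} j ∧
          Φ x = toLex (i, j) := by
  have hlt := fun i => lt_of_strictAnti_tendsto (hanti i) (hlim i)
  have hD := derivedSet_diff_zero hanti hlim hpos hfin hA
  rw [hD]
  have hβex : ∃! β : ℕ+ → ℝ, IsDecreasingEnumeration β (range τ) := by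
    refine existsUnique_isDecreasingEnumeration (infinite_range_limit hanti hlim hpos hfin) ?_
    rintro _ ⟨i, rfl⟩
    exact finite_range_inter_Ioi hanti hlim hfin (hpos i)
  have hex : ∀ β : ℕ+ → ℝ, IsDecreasingEnumeration β (range τ) → ∀ x ∈ tSet, ∃ r, β r < x := by
    rintro β hβ x hx
    rw [hA] at hx
    obtain ⟨i, n, rfl⟩ := hx
    obtain ⟨r, hr⟩ : τ i ∈ range β := hβ.2 ▸ mem_range_self i
    exact ⟨r, hr ▸ hlt i n⟩
  have hblock : ∀ β : ℕ+ → ℝ, IsDecreasingEnumeration β (range τ) →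
      ∀ i : ℕ+, ∃! a : ℕ+ → ℝ, IsDecreasingEnumeration a (block β i) := by
    intro β hβ i
    obtain ⟨c, hc⟩ : β i ∈ range τ := hβ.2 ▸ mem_range_self i
    refine existsUnique_isDecreasingEnumeration ?_ fun x hx => ?_
    -- A sequence with limit `β i` eventually stays in the block; for `i = 1` there is no upper
    -- bound to check.
    · have hev : ∃ N, ∀ n ≥ N, T c n ∈ block β i := by
        have h : ∀ᶠ n in atTop, ∀ j : ℕ+, j + 1 = i → T c n ≤ β j := by
          by_cases hi : ∃ j : ℕ+, j + 1 = i
          · obtain ⟨j, hj⟩ := hi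
            have hji : τ c < β j := hc ▸ hβ.1 (hj ▸ PNat.lt_add_right j 1)
            filter_upwards [(hlim c).eventually_lt_const hji] with n hn j' hj'
            rw [add_right_cancel (hj'.trans hj.symm)]
            exact hn.le
          · exact Eventually.of_forall fun n j hj => (hi ⟨j, hj⟩).elim
        obtain ⟨N, hN⟩ := eventually_atTop.1 h
        exact ⟨N, fun n hn => ⟨hA ▸ ⟨c, n, rfl⟩, hc ▸ hlt c n, hN n hn⟩⟩
      obtain ⟨N, hN⟩ := hev
      exact ((Set.Ici_infinite N).image (hanti c).injective.injOn).mono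
        (image_subset_iff.2 fun n hn => hN n hn)
    · refine finite_of_eventually_avoid hanti hlim hfin ((hc ▸ hpos c).trans hx.2.1)
        (fun y hy => ⟨hy.2, ?_⟩) fun k => ?_
      · have := hy.1.1
        rwa [hA] at this
      -- If `r < i`, all terms lie above `β r` and so above the block; if `r ≥ i`, the limit is at
      -- most `β i < x`.
      · obtain ⟨r, hr⟩ : τ k ∈ range β := hβ.2 ▸ mem_range_self k
        rcases lt_or_ge r i with h | h
        · refine Or.inr fun n hn => not_lt.2 (le_of_mem_block hβ.1 hn.1 h) ?_
          exact hr ▸ hlt k n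
        · exact Or.inl (hr ▸ (hβ.1.antitone h).trans_lt hx.2.1)
  refine ⟨?_, hβex, fun β hβ => ⟨hblock β hβ, fun α hα Φ hΦ x => ?_⟩⟩
  · obtain ⟨β, hβ, -⟩ := hβex
    choose α hα using fun i => (hblock β hβ i).exists
    obtain ⟨Φ, hΦ, -⟩ := exists_isReversingBijection hβ.1 (hex β hβ) hα
    exact ⟨Φ, hΦ, fun Ψ hΨ => hΨ.unique hΦ⟩
  · obtain ⟨Ψ, hΨ, hval⟩ := exists_isReversingBijection hβ.1 (hex β hβ) hα
    obtain ⟨i, hi⟩ := exists_mem_block x.2 (hex β hβ x x.2)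
    obtain ⟨j, hj⟩ : (x : ℝ) ∈ range (α i) := (hα i).2 ▸ hi
    refine ⟨i, j, isLeast_of_mem_block hβ.1 hi, ⟨hj.le, fun s hs => ?_⟩, ?_⟩
    · have hs' : α i s ≤ α i j := hj ▸ hs
      exact (hα i).1.le_iff_ge.1 hs'
    · rw [hΦ.unique hΨ]
      exact hval x i j hj

/-! ### Summability -/

/-- The majorant of the series, with chains encoded as finite sets of shifted indices. -/
noncomputable def finsetWeight (s : Finset ℕ) : ℝ :=
  1 / (2 * (s.sup id : ℕ) + 1) * ∏ n ∈ s, (1 / (2 * (n : ℝ) + 1))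

theorem finsetWeight_nonneg (s : Finset ℕ) : 0 ≤ finsetWeight s := by
  unfold finsetWeight; positivity

/-- The second summand is a potential that pays for the sets still to come: those with maximum `N`
weigh `1 / (2N+1)^2` times the product. The constant `3` is the least that works, with equality at
`N = 0`. -/
theorem sum_powerset_range_finsetWeight (N : ℕ) :
    ∑ s ∈ (Finset.range N).powerset, finsetWeight s +
      3 / (2 * N + 1) * ∏ n ∈ Finset.range N, (1 + 1 / (2 * (n : ℝ) + 1)) ≤ 4 := by
  induction N with
  | zero => simp [finsetWeight]; norm_num
  | succ N ih =>
    have hsum : ∑ s ∈ (Finset.range N).powerset, finsetWeight (insert N s) =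
        1 / (2 * (N : ℝ) + 1) ^ 2 * ∏ n ∈ Finset.range N, (1 + 1 / (2 * (n : ℝ) + 1)) := by
      rw [Finset.prod_one_add, Finset.mul_sum]
      refine Finset.sum_congr rfl fun s hs => ?_
      have hs' : ∀ n ∈ s, n < N := fun n hn => Finset.mem_range.1 (Finset.mem_powerset.1 hs hn)
      have hN : N ∉ s := fun h => lt_irrefl _ (hs' N h)
      have hsup : (insert N s).sup id = N := by
        rw [Finset.sup_insert]
        exact sup_eq_left.2 (Finset.sup_le fun n hn => (hs' n hn).le)
      rw [finsetWeight, hsup, Finset.prod_insert hN]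
      field_simp
    rw [Finset.range_add_one, Finset.sum_powerset_insert (by simp), hsum,
      Finset.prod_insert (by simp)]
    set P := ∏ n ∈ Finset.range N, (1 + 1 / (2 * (n : ℝ) + 1)) with hP
    have hP0 : 0 ≤ P := by positivity
    have key : 1 / (2 * (N : ℝ) + 1) ^ 2 +
        3 / (2 * ((N + 1 : ℕ) : ℝ) + 1) * (1 + 1 / (2 * (N : ℝ) + 1)) ≤ 3 / (2 * (N : ℝ) + 1) := by
      push_cast
      have hN : (0 : ℝ) ≤ N := N.cast_nonneg
      rw [← sub_nonneg]
      have : 3 / (2 * (N : ℝ) + 1) - (1 / (2 * (N : ℝ) + 1) ^ 2 +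
          3 / (2 * ((N : ℝ) + 1) + 1) * (1 + 1 / (2 * (N : ℝ) + 1))) =
          4 * N / ((2 * N + 1) ^ 2 * (2 * (N + 1) + 1)) := by
        field_simp
        ring
      rw [this]
      positivity
    nlinarith [mul_le_mul_of_nonneg_right key hP0]

theorem summable_finsetWeight : Summable finsetWeight := by
  refine summable_of_sum_le finsetWeight_nonneg (c := 4) fun u => ?_
  obtain ⟨N, hN⟩ : ∃ N, u ⊆ (Finset.range N).powerset := by
    refine ⟨u.sup (fun s => s.sup id) + 1, fun s hs => Finset.mem_powerset.2 fun n hn => ?_⟩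
    rw [Finset.mem_range, Nat.lt_succ_iff]
    exact (Finset.le_sup (f := id) hn).trans (Finset.le_sup (f := fun s : Finset ℕ => s.sup id) hs)
  refine (Finset.sum_le_sum_of_subset_of_nonneg hN fun s _ _ => finsetWeight_nonneg s).trans ?_
  refine le_trans (le_add_of_nonneg_right ?_) (sum_powerset_range_finsetWeight N)
  positivity

/-- The smallest exponent allowed at each place of an admissible multi-index. -/
def minExp (i : ℕ) : ℕ := if i = 0 then 2 else 1

/-- The general term of the series of a multiple `t`-value. -/
noncomputable def term {d : ℕ} (k : Fin d → ℕ) (m : Chain d) : ℝ :=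
  1 / ∏ i, (2 * (m.1 i : ℝ) - 1) ^ k i

theorem Chain.one_le {d : ℕ} (m : Chain d) (i : Fin d) : (1 : ℝ) ≤ 2 * (m.1 i : ℝ) - 1 := by
  have : (1 : ℝ) ≤ m.1 i := by exact_mod_cast m.2.2 i
  linarith

theorem term_pos {d : ℕ} (k : Fin d → ℕ) (m : Chain d) : 0 < term k m :=
  one_div_pos.2 (Finset.prod_pos fun i _ => pow_pos (one_pos.trans_le (m.one_le i)) _)

theorem term_antitone {d : ℕ} {k l : Fin d → ℕ} (h : k ≤ l) (m : Chain d) :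
    term l m ≤ term k m := by
  refine one_div_le_one_div_of_le
    (Finset.prod_pos fun i _ => pow_pos (one_pos.trans_le (m.one_le i)) _) ?_
  exact Finset.prod_le_prod (fun i _ => (pow_pos (one_pos.trans_le (m.one_le i)) _).le)
    fun i _ => pow_le_pow_right₀ (m.one_le i) (h i)

/-- The finite set of shifted indices of a chain. -/
def Chain.toFinset {d : ℕ} (m : Chain d) : Finset ℕ :=
  Finset.univ.image fun i => m.1 i - 1

theorem Chain.injective_sub {d : ℕ} (m : Chain d) : Function.Injective fun i => m.1 i - 1 := by
  intro i j h
  have hi := m.2.2 i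
  have hj := m.2.2 j
  change m.1 i - 1 = m.1 j - 1 at h
  exact m.2.1.injective (by omega)

/-- The cardinality recovers the depth and the range recovers the chain, so one series over finite
sets controls all depths at once. -/
theorem Chain.toFinset_injective :
    Function.Injective fun p : Σ d, Chain d => p.2.toFinset := by
  rintro ⟨d, m⟩ ⟨d', m'⟩ h
  simp only [Chain.toFinset] at h
  have hd : d = d' := by
    have := congrArg Finset.card h
    rwa [Finset.card_image_of_injective _ m.injective_sub,
      Finset.card_image_of_injective _ m'.injective_sub, Finset.card_fin, Finset.card_fin] at this
  subst hd
  have hanti : ∀ m : Chain d, StrictAnti fun i => m.1 i - 1 := fun m i j hij => by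
    have h1 := m.2.1 hij
    have h2 := m.2.2 j
    change m.1 j - 1 < m.1 i - 1
    omega
  have hr : range (fun i => m.1 i - 1) = range fun i => m'.1 i - 1 := by
    have := congrArg (fun s : Finset ℕ => (s : Set ℕ)) h
    simpa using this
  have hf := (StrictAnti.range_inj (hanti m) (hanti m')).1 hr
  have : m = m' := by
    refine Subtype.ext (funext fun i => ?_)
    have h1 : m.1 i - 1 = m'.1 i - 1 := congrFun hf i
    have h2 := m.2.2 i
    have h3 := m'.2.2 i
    omega
  rw [this]

/-- The first exponent `2` accounts for the extra factor at the maximum. -/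
theorem term_minExp {d : ℕ} (m : Chain (d + 1)) :
    term (fun i => minExp i) m = finsetWeight m.toFinset := by
  have hcast : ∀ i, 2 * ((m.1 i - 1 : ℕ) : ℝ) + 1 = 2 * (m.1 i : ℝ) - 1 := fun i => by
    rw [Nat.cast_sub (m.2.2 i)]
    push_cast
    ring
  have hsup : m.toFinset.sup id = m.1 0 - 1 := by
    rw [Chain.toFinset, Finset.sup_image]
    refine le_antisymm (Finset.sup_le fun i _ => ?_)
      (Finset.le_sup (f := id ∘ fun i => m.1 i - 1) (Finset.mem_univ 0))
    exact Nat.sub_le_sub_right (m.2.1.antitone (Fin.zero_le i)) 1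
  rw [finsetWeight, hsup, Chain.toFinset, Finset.prod_image m.injective_sub.injOn, hcast]
  simp_rw [hcast]
  rw [term, Fin.prod_univ_succ, Fin.prod_univ_succ]
  simp [minExp, pow_two, mul_comm, mul_assoc]

theorem summable_sigma_term :
    Summable fun p : Σ r, Chain (r + 1) => term (fun i => minExp i) p.2 := by
  have hinj : Function.Injective fun p : Σ r, Chain (r + 1) => p.2.toFinset := by
    rintro ⟨r, m⟩ ⟨r', m'⟩ h
    have := @Chain.toFinset_injective ⟨r + 1, m⟩ ⟨r' + 1, m'⟩ h
    obtain ⟨h1, h2⟩ := Sigma.mk.inj_iff.1 this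
    obtain rfl : r = r' := by omega
    rw [eq_of_heq h2]
  exact (summable_finsetWeight.comp_injective hinj).congr fun p => (term_minExp p.2).symm

theorem summable_minExp (r : ℕ) : Summable (term (fun i : Fin (r + 1) => minExp i)) :=
  summable_sigma_term.sigma_factor r

theorem summable_term {r : ℕ} {k : Fin (r + 1) → ℕ} (hk : ∀ i : Fin (r + 1), minExp i ≤ k i) :
    Summable (term k) :=
  (summable_minExp r).of_nonneg_of_le (fun m => (term_pos k m).le) fun m => term_antitone hk m

theorem tValue_eq {d : ℕ} (k : Fin d → ℕ) : tValue k = ∑' m, term k m := rfl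

theorem isAdmissible_iff {r : ℕ} {k : Fin (r + 1) → ℕ} :
    IsAdmissible k ↔ ∀ i : Fin (r + 1), minExp i ≤ k i := by
  constructor
  · rintro ⟨h1, h, h2⟩ i
    rcases eq_or_ne i 0 with rfl | hi
    · exact h2
    · have : (i : ℕ) ≠ 0 := fun h => hi (Fin.ext h)
      simpa [minExp, this] using Nat.succ_le_of_lt (h1 i)
  · intro h
    refine ⟨fun i => lt_of_lt_of_le ?_ (h i), Nat.succ_pos r, h 0⟩
    unfold minExp
    split_ifs <;> norm_num

/-! ### The families with all but the last exponent fixed -/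

/-- The multi-index with excess `e` over the minimal one, followed by a last entry of excess `n`. -/
def index {r : ℕ} (e : Fin r → ℕ) (n : ℕ) : Fin (r + 1) → ℕ :=
  fun i => minExp i + (Fin.snoc e n : Fin (r + 1) → ℕ) i

theorem minExp_le_index {r : ℕ} (e : Fin r → ℕ) (n : ℕ) (i : Fin (r + 1)) :
    minExp i ≤ index e n i := Nat.le_add_right _ _

theorem tSet_eq : tSet =
    {x | ∃ (p : Σ r, Fin r → ℕ) (n : ℕ), tValue (index p.2 n) = x} := by
  ext x
  constructor
  · rintro ⟨d, k, hk, rfl⟩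
    obtain ⟨-, hd, -⟩ := id hk
    obtain ⟨r, rfl⟩ := Nat.exists_eq_succ_of_ne_zero hd.ne'
    have h := isAdmissible_iff.1 hk
    refine ⟨⟨r, Fin.init fun i => k i - minExp i⟩, k (Fin.last r) - minExp (Fin.last r), ?_⟩
    congr 1
    funext i
    rw [index, Fin.snoc_init_self (fun i : Fin (r + 1) => k i - minExp i)]
    exact Nat.add_sub_cancel' (h i)
  · rintro ⟨⟨r, e⟩, n, rfl⟩
    exact ⟨r + 1, index e n, isAdmissible_iff.2 (minExp_le_index e n), rfl⟩

theorem term_index {r : ℕ} (e : Fin r → ℕ) (n : ℕ) (m : Chain (r + 1)) :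
    term (index e n) m = term (index e 0) m * (1 / (2 * (m.1 (Fin.last r) : ℝ) - 1)) ^ n := by
  simp only [term, index, Fin.prod_univ_castSucc, Fin.snoc_castSucc, Fin.snoc_last, pow_add,
    pow_zero, mul_one, one_div, mul_inv, inv_pow]
  ring

/-- The chain `c + r > ⋯ > c + 1`. -/
def Chain.consecutive (c r : ℕ) : Chain (r + 1) :=
  ⟨fun i => c + (r + 1 - i), fun i j h => by
    have h' : (i : ℕ) < j := h
    have := j.2
    change c + (r + 1 - (j : ℕ)) < c + (r + 1 - (i : ℕ))
    omega, fun i => by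
    change 0 < c + (r + 1 - (i : ℕ))
    omega⟩

theorem Chain.consecutive_last (c r : ℕ) : (Chain.consecutive c r).1 (Fin.last r) = c + 1 := by
  simp [Chain.consecutive]

theorem strictAnti_tValue_index {r : ℕ} (e : Fin r → ℕ) :
    StrictAnti fun n => tValue (index e n) := by
  refine strictAnti_nat_of_succ_lt fun n => ?_
  have hs := fun n => summable_term (minExp_le_index e n)
  -- Strictness needs a chain whose last entry is not `1`; this one ends in `2`, with ratio `1/3`.
  refine Summable.tsum_lt_tsum (i := Chain.consecutive 1 r) (fun m => ?_) ?_ (hs (n + 1)) (hs n)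
  · refine term_antitone (fun i => ?_) m
    unfold index
    induction i using Fin.lastCases <;> simp
  · change term (index e (n + 1)) _ < term (index e n) _
    rw [term_index e (n + 1), term_index e n, Chain.consecutive_last]
    refine mul_lt_mul_of_pos_left ?_ (term_pos _ _)
    exact pow_lt_pow_right_of_lt_one₀ (by norm_num) (by norm_num) (Nat.lt_succ_self n)

open Classical in
/-- The limit of the multiple `t`-values as the last exponent tends to infinity. -/
noncomputable def limitValue {r : ℕ} (e : Fin r → ℕ) : ℝ :=
  ∑' m : Chain (r + 1), if m.1 (Fin.last r) = 1 then term (index e 0) m else 0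

/-- Dominated convergence: each term carries the `n`-th power of a ratio that is `1` if the last
entry is `1`, and less than `1` otherwise. -/
theorem tendsto_tValue_index {r : ℕ} (e : Fin r → ℕ) :
    Tendsto (fun n => tValue (index e n)) atTop (𝓝 (limitValue e)) := by
  refine tendsto_tsum_of_dominated_convergence (bound := term (index e 0))
    (summable_term (minExp_le_index e 0)) (fun m => ?_) (Eventually.of_forall fun n m => ?_)
  · change Tendsto (fun n => term (index e n) m) _ _
    rw [funext fun n => term_index e n m]
    have h1 := m.2.2 (Fin.last r)
    split_ifs with h
    · rw [h]
      norm_num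
    · have h2 : (2 : ℝ) ≤ m.1 (Fin.last r) := by exact_mod_cast (by omega : 2 ≤ m.1 (Fin.last r))
      rw [← mul_zero (term (index e 0) m)]
      refine (tendsto_pow_atTop_nhds_zero_of_lt_one (one_div_nonneg.2 (by linarith)) ?_).const_mul _
      rw [div_lt_one (by linarith)]
      linarith
  · change ‖term (index e n) m‖ ≤ _
    rw [Real.norm_of_nonneg (term_pos _ _).le]
    refine term_antitone (fun i => ?_) m
    unfold index
    induction i using Fin.lastCases <;> simp

theorem limitValue_pos {r : ℕ} (e : Fin r → ℕ) : 0 < limitValue e := by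
  have hs : Summable fun m : Chain (r + 1) =>
      if m.1 (Fin.last r) = 1 then term (index e 0) m else 0 := by
    refine (summable_term (minExp_le_index e 0)).of_nonneg_of_le (fun m => ?_) fun m => ?_ <;>
      split_ifs <;> first | exact (term_pos _ _).le | exact le_rfl
  unfold limitValue
  refine hs.tsum_pos (fun m => ?_) (Chain.consecutive 0 r) ?_
  · split_ifs
    exacts [(term_pos _ _).le, le_rfl]
  · rw [if_pos (Chain.consecutive_last 0 r)]
    exact term_pos _ _

/-- The weight of depth `r + 1`, that is `t(2, 1, …, 1)`. -/
noncomputable def depthWeight (r : ℕ) : ℝ := tValue fun i : Fin (r + 1) => minExp i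

/-- These are the partial sums, depth by depth, of one convergent series over all chains. -/
theorem tendsto_depthWeight : Tendsto depthWeight atTop (𝓝 0) :=
  summable_sigma_term.sigma.tendsto_atTop_zero

theorem tValue_index_le_depthWeight {r : ℕ} (e : Fin r → ℕ) (n : ℕ) :
    tValue (index e n) ≤ depthWeight r :=
  (summable_term (minExp_le_index e n)).tsum_le_tsum
    (fun m => term_antitone (minExp_le_index e n) m) (summable_minExp r)

/-- A non-last entry exceeds the last one, so it is at least `2` and its factor `2m - 1` is at least
`3`. -/
theorem term_index_le {r : ℕ} (e : Fin r → ℕ) (i : Fin r) (m : Chain (r + 1)) :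
    term (index e 0) m ≤ (1 / 3) ^ e i * term (fun i : Fin (r + 1) => minExp i) m := by
  have hi : (3 : ℝ) ≤ 2 * (m.1 i.castSucc : ℝ) - 1 := by
    have h1 := m.2.1 (Fin.castSucc_lt_last i)
    have h2 := m.2.2 (Fin.last r)
    have : (2 : ℝ) ≤ m.1 i.castSucc := by exact_mod_cast (by omega : 2 ≤ m.1 i.castSucc)
    linarith
  have hprod : (3 : ℝ) ^ e i * ∏ j, (2 * (m.1 j : ℝ) - 1) ^ minExp j ≤
      ∏ j, (2 * (m.1 j : ℝ) - 1) ^ index e 0 j := by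
    simp only [index, pow_add, Finset.prod_mul_distrib]
    rw [mul_comm]
    refine mul_le_mul_of_nonneg_left ?_
      (Finset.prod_nonneg fun j _ => pow_nonneg (zero_le_one.trans (m.one_le j)) _)
    rw [← Finset.mul_prod_erase _ _ (Finset.mem_univ i.castSucc), Fin.snoc_castSucc]
    refine (pow_le_pow_left₀ (by norm_num) hi _).trans (le_mul_of_one_le_right ?_ ?_)
    · exact pow_nonneg (zero_le_one.trans (m.one_le _)) _
    · exact Finset.one_le_prod fun j _ => one_le_pow₀ (m.one_le j)
  have h0 : 0 < ∏ j, (2 * (m.1 j : ℝ) - 1) ^ minExp j :=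
    Finset.prod_pos fun j _ => pow_pos (one_pos.trans_le (m.one_le j)) _
  change 1 / ∏ j, (2 * (m.1 j : ℝ) - 1) ^ index e 0 j ≤
    (1 / 3) ^ e i * (1 / ∏ j, (2 * (m.1 j : ℝ) - 1) ^ minExp j)
  rw [one_div_pow, one_div_mul_one_div]
  exact one_div_le_one_div_of_le (by positivity) hprod

theorem tValue_index_le {r : ℕ} (e : Fin r → ℕ) (i : Fin r) :
    tValue (index e 0) ≤ (1 / 3) ^ e i * depthWeight r := by
  rw [depthWeight, tValue_eq, tValue_eq, ← tsum_mul_left]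
  exact (summable_term (minExp_le_index e 0)).tsum_le_tsum (fun m => term_index_le e i m)
    ((summable_minExp r).mul_left _)

theorem finite_setOf_lt_tValue {ε : ℝ} (hε : 0 < ε) :
    {p : Σ r, Fin r → ℕ | ε < tValue (index p.2 0)}.Finite := by
  obtain ⟨D, hD⟩ := eventually_atTop.1 (tendsto_depthWeight.eventually_lt_const hε)
  have hK : ∀ r, ∃ K, ∀ n ≥ K, (1 / 3 : ℝ) ^ n * depthWeight r < ε := fun r => by
    have h : Tendsto (fun n : ℕ => (1 / 3 : ℝ) ^ n * depthWeight r) atTop (𝓝 0) := by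
      simpa using (tendsto_pow_atTop_nhds_zero_of_lt_one (by norm_num : (0 : ℝ) ≤ 1 / 3)
        (by norm_num)).mul_const (depthWeight r)
    exact eventually_atTop.1 (h.eventually_lt_const hε)
  choose K hK using hK
  -- The depth is bounded by `D`, and at depth parameter `r` every excess is below `K r`.
  refine ((finite_lt_nat D).biUnion fun r _ => (Set.Finite.pi fun _ : Fin r =>
    finite_lt_nat (K r)).image (Sigma.mk (β := fun r => Fin r → ℕ) r)).subset ?_
  rintro ⟨r, e⟩ h
  refine mem_biUnion (x := r) (show r < D from not_le.1 fun hr => ?_)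
    ⟨e, fun i _ => show e i < K r from not_le.1 fun hi => ?_, rfl⟩
  · exact lt_asymm (hD r hr) (h.trans_le (tValue_index_le_depthWeight e 0))
  · exact lt_asymm (hK r (e i) hi) (h.trans_le (tValue_index_le e i))

instance : Infinite (Σ r, Fin r → ℕ) :=
  Infinite.of_injective (fun r => ⟨r, 0⟩) fun _ _ h => congrArg Sigma.fst h

end MultipleT

theorem mainTheorem7 :
    (∃! Φ : MultipleT.tSet → ℕ+ ×ₗ ℕ+, MultipleT.IsReversingBijection Φ) ∧
    (∃! β : ℕ+ → ℝ,
      MultipleT.IsDecreasingEnumeration β (derivedSet MultipleT.tSet \ {0})) ∧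
    ∀ β : ℕ+ → ℝ,
      MultipleT.IsDecreasingEnumeration β (derivedSet MultipleT.tSet \ {0}) →
      (∀ i : ℕ+, ∃! a : ℕ+ → ℝ,
        MultipleT.IsDecreasingEnumeration a (MultipleT.block β i)) ∧
      ∀ α : ℕ+ → ℕ+ → ℝ,
        (∀ i : ℕ+, MultipleT.IsDecreasingEnumeration (α i) (MultipleT.block β i)) →
        ∀ Φ : MultipleT.tSet → ℕ+ ×ₗ ℕ+, MultipleT.IsReversingBijection Φ →
        ∀ x : MultipleT.tSet, ∃ i j : ℕ+,
          IsLeast {r : ℕ+ | (x : ℝ) > β r} i ∧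
          IsLeast {s : ℕ+ | (x : ℝ) ≥ α i s} j ∧
          Φ x = toLex (i, j) :=
  MultipleT.order_structure_of_family
    (T := fun (p : Σ r, Fin r → ℕ) n => MultipleT.tValue (MultipleT.index p.2 n))
    (fun p => MultipleT.strictAnti_tValue_index p.2)
    (fun p => MultipleT.tendsto_tValue_index p.2)
    (fun p => MultipleT.limitValue_pos p.2)
    (fun _ hε => MultipleT.finite_setOf_lt_tValue hε)
    MultipleT.tSet_eq
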